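/- For every integer $t\ge 2$ there is a real constant $D_t\ge 0$ such that the following holds for every integer $r\ge 2$. (A matching of size $t$ in an $r$-uniform hypergraph is a set of $t$ pairwise disjoint edges.) (a) There exist an $r$-uniform hypergraph on exactly $tr$ vertices, an integer $$N\ge\left(\frac{t^t}{(t-1)^{t-1}}\right)^{r-D_t\sqrt r},$$ and matchings $M_1,\dots,M_N$ of size $t$ in this hypergraph such that, for all indices $j_1,\dots,j_t\in\{1,\dots,N\}$ and all pairwise disjoint edges $e_1\in M_{j_1},\dots,e_t\in M_{j_t}$, we have $j_1=\dots=j_t$. (b) Consequently, $$F(r,t)\ge\left(\frac{t^t}{(t-1)^{t-1}}\right)^{r-D_t\sqrt r}.$$ Here $F(r,t)$ denotes the maximum possible number $N$ of (not necessarily distinct) matchings $M_1,\dots,M_N$ of size $t$ in some $r$-uniform hypergraph, with any number of vertices, that have no rainbow matching of size $t$, i.e. for which there do not exist distinct indices $i_1,\dots,i_t$ and pairwise disjoint edges $e_1\in M_{i_1},\dots,e_t\in M_{i_t}$. -/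

import Mathlib

/-- An `r`-uniform hypergraph on the vertex set `V`: a collection of edges, each of which is a set
of exactly `r` vertices. -/
structure UniformHypergraph (V : Type) (r : ℕ) where
  edges : Set (Finset V)
  card_eq : ∀ e ∈ edges, e.card = r

namespace UniformHypergraph

variable {V : Type} {r : ℕ}

/-- `M` is a matching of size `t` in `H`: it consists of `t` pairwise disjoint edges of `H`. -/
def IsMatchingOfSize (H : UniformHypergraph V r) (t : ℕ) (M : Finset (Finset V)) : Prop :=
  (∀ e ∈ M, e ∈ H.edges) ∧ M.card = t ∧ ∀ e ∈ M, ∀ e' ∈ M, e ≠ e' → Disjoint e e'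

end UniformHypergraph

/-- The family `M 1, …, M N` has a rainbow matching of size `t`: there are distinct indices
`i 1, …, i t` and pairwise disjoint edges `e 1 ∈ M (i 1), …, e t ∈ M (i t)`. -/
def HasRainbowMatching {V : Type} {N : ℕ} (t : ℕ) (M : Fin N → Finset (Finset V)) : Prop :=
  ∃ (i : Fin t → Fin N) (e : Fin t → Finset V),
    Function.Injective i ∧ (∀ k, e k ∈ M (i k)) ∧ ∀ k l, k ≠ l → Disjoint (e k) (e l)

/-- There are `N` (not necessarily distinct) matchings of size `t` in some `r`-uniform hypergraph
without a rainbow matching of size `t`. -/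
def ExistsRainbowFreeFamily (r t N : ℕ) : Prop :=
  ∃ (V : Type) (H : UniformHypergraph V r) (M : Fin N → Finset (Finset V)),
    (∀ j, H.IsMatchingOfSize t (M j)) ∧ ¬ HasRainbowMatching t M

/-- `F(r,t)`: the maximum possible number of matchings of size `t` in some `r`-uniform hypergraph
without a rainbow matching of size `t`. It is taken as a supremum in `ℕ∞`, which is the maximum
whenever the admissible numbers are bounded, and carries no default value otherwise. -/
noncomputable def rainbowF (r t : ℕ) : ℕ∞ :=
  ⨆ N : {N : ℕ // ExistsRainbowFreeFamily r t N}, ((N : ℕ) : ℕ∞)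

/-!
Write `t = n + 1` and let the vertex set have `(n + 1) * r` elements, of which `n + 1` are marked
`u 0, …, u n`. A matching of size `t` is given as the set of colour classes of a colouring with
`n + 1` colours, all classes having size `r`, in which `u c` has colour `c`. Two classes of the same
colour always meet, so disjoint edges from `t` such matchings carry all the colours once each and
are the classes of another colouring of this kind. It remains to find many colourings such that no
colouring can be put together from classes of different ones.

This is done by hashing. Let `F` be a finite field and `S ⊆ F` a set in which `x₁ + ⋯ + xₙ = n y`
has only the solutions with all variables equal. For a weight `w : V → F`, select the colourings
whose classes have weights `-n s, s, …, s` for some `s ∈ S`. The weights of the classes of any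
colouring add up to the total weight, so a colouring put together from classes of selected ones
yields a solution of the equation in `S`, and is therefore selected itself
(`eq_of_mem_isolatedColorings`). Hence the selected colourings that share no class with another
selected one have the required property.

They are counted by averaging over `w` (`exists_card_isolatedColorings`). The probability that `A`
and `B` are both selected depends on the rank of a system of linear equations; its defect is
measured by the number of `α : Fin (n + 1) → F` with `α ∘ A = α ∘ B` (`card_colorSum_pair_le`).
Summing these numbers over all `B` that share a class with `A`, and exchanging the sums over `α`
and `B`, bounds the expected number of conflicts (`sum_near_le`). This uses the
inequality `a ^ a ≤ β ^ (a - 1)` for `1 ≤ a ≤ n`, where `β = n ^ (n / (n - 1))`, and shows that a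
field with about `β ^ r` elements is large enough.

The number of balanced colourings is `t ^ (t r)` up to a polynomial factor, and each is selected
with probability `|S| / |F| ^ n` by a weight with total zero, where `|F| ^ (n - 1)` is about `n ^ (n r)`. This leaves
`(t ^ t / n ^ n) ^ r` times the density of `S`, which is `exp (-O(√r))` by Behrend's construction:
as an additive group `F` is `(ZMod q) ^ k` with `k` about `√r`, and `S` consists of points on a
sphere in a box so small that sums of `n` vectors do not wrap around.
-/

/-! ### Sets without nontrivial averages -/

/-- `S` contains no nontrivial averages of `n` terms: if the sum of `n` elements of `S` is
`n` times an element `y` of `S`, then all of them are equal to `y`. -/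
def AverageFree {G : Type*} [AddCommMonoid G] (n : ℕ) (S : Finset G) : Prop :=
  ∀ x : Fin n → G, (∀ i, x i ∈ S) → ∀ y ∈ S, ∑ i, x i = n • y → ∀ i, x i = y

lemma AverageFree.map {G H : Type*} [AddCommMonoid G] [AddCommMonoid H] {n : ℕ} {S : Finset G}
    (hS : AverageFree n S) (e : G ≃+ H) : AverageFree n (S.map e.toEquiv.toEmbedding) := by
  intro x hx y hy hxy i
  have hmem : ∀ z, z ∈ S.map e.toEquiv.toEmbedding → e.symm z ∈ S := by
    intro z hz
    obtain ⟨a, ha, rfl⟩ := Finset.mem_map.1 hz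
    simpa using ha
  have h := hS (fun i => e.symm (x i)) (fun i => hmem _ (hx i)) (e.symm y) (hmem _ hy)
    (by rw [← map_sum, hxy, map_nsmul]) i
  exact e.symm.injective h

/-- The points of a sphere have no nontrivial averages. -/
lemma eq_of_sum_eq_of_sum_sq_eq {n k : ℕ} (R : ℤ) (X : Fin n → Fin k → ℤ) (Y : Fin k → ℤ)
    (hX : ∀ i, ∑ j, X i j ^ 2 = R) (hY : ∑ j, Y j ^ 2 = R)
    (h : ∀ j, ∑ i, X i j = n * Y j) (i : Fin n) (j : Fin k) : X i j = Y j := by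
  have key : ∑ i, ∑ j, (X i j - Y j) ^ 2 = 0 := by
    have h1 : ∑ i, ∑ j, (X i j - Y j) ^ 2
        = ∑ i, ∑ j, X i j ^ 2 - 2 * ∑ j, Y j * ∑ i, X i j + n * ∑ j, Y j ^ 2 := by
      have h2 : ∑ j, Y j * ∑ i, X i j = ∑ i, ∑ j, Y j * X i j := by
        rw [Finset.sum_comm]
        exact Finset.sum_congr rfl fun j _ => Finset.mul_sum _ _ _
      have h3 : (n : ℤ) * ∑ j, Y j ^ 2 = ∑ _i : Fin n, ∑ j, Y j ^ 2 := by simp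
      rw [h2, h3, Finset.mul_sum, ← Finset.sum_sub_distrib, ← Finset.sum_add_distrib]
      refine Finset.sum_congr rfl fun i _ => ?_
      rw [Finset.mul_sum, ← Finset.sum_sub_distrib, ← Finset.sum_add_distrib]
      exact Finset.sum_congr rfl fun j _ => by ring
    have h4 : ∑ j, Y j * ∑ i, X i j = n * R := by
      rw [← hY, Finset.mul_sum]
      exact Finset.sum_congr rfl fun j _ => by rw [h]; ring
    rw [h1, h4, hY]
    simp only [hX, Finset.sum_const, Finset.card_univ, Fintype.card_fin, nsmul_eq_mul]
    ring
  rw [Finset.sum_eq_zero_iff_of_nonneg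
    fun i _ => Finset.sum_nonneg fun j _ => sq_nonneg _] at key
  have h5 := key i (Finset.mem_univ i)
  rw [Finset.sum_eq_zero_iff_of_nonneg fun j _ => sq_nonneg _] at h5
  have h6 := pow_eq_zero_iff (two_ne_zero) |>.1 (h5 j (Finset.mem_univ j))
  linarith

/-- Behrend's construction in `(ZMod q) ^ k`: a most popular sphere in the box `[0, d) ^ k`, where
`n * (d - 1) < q` ensures that sums of `n` vectors of the box do not wrap around. -/
lemma exists_averageFree_pi {n k q d : ℕ} (hn : 1 ≤ n) (hk : 1 ≤ k) (hd : 1 ≤ d)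
    (hq : n * (d - 1) < q) :
    ∃ S : Finset (Fin k → ZMod q), AverageFree n S ∧ d ^ k ≤ S.card * (k * d ^ 2) := by
  classical
  have hdq : d ≤ q := by
    have : 1 * (d - 1) ≤ n * (d - 1) := Nat.mul_le_mul_right _ hn
    omega
  set box : Finset (Fin k → ℕ) := Fintype.piFinset fun _ => Finset.range d with hbox
  have hmem : ∀ X ∈ box, ∀ j, X j < d := by
    intro X hX j
    simpa using Fintype.mem_piFinset.1 hX j
  have hmaps : ∀ X ∈ box, ∑ j, X j ^ 2 ∈ Finset.range (k * d ^ 2) := by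
    intro X hX
    rw [Finset.mem_range]
    have : Nonempty (Fin k) := ⟨⟨0, hk⟩⟩
    calc ∑ j, X j ^ 2 < ∑ _j : Fin k, d ^ 2 :=
          Finset.sum_lt_sum_of_nonempty Finset.univ_nonempty
            fun j _ => Nat.pow_lt_pow_left (hmem X hX j) two_ne_zero
      _ = k * d ^ 2 := by simp
  have hne : (Finset.range (k * d ^ 2)).Nonempty := by
    rw [Finset.nonempty_range_iff]
    positivity
  obtain ⟨R, -, hR⟩ := Finset.exists_max_image (Finset.range (k * d ^ 2))
    (fun R => (box.filter fun X => ∑ j, X j ^ 2 = R).card) hne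
  set B := box.filter fun X => ∑ j, X j ^ 2 = R with hB
  have hcardB : d ^ k ≤ B.card * (k * d ^ 2) := by
    have h1 := Finset.card_eq_sum_card_fiberwise (f := fun X : Fin k → ℕ => ∑ j, X j ^ 2)
      (s := box) (t := Finset.range (k * d ^ 2)) hmaps
    have h2 : box.card = d ^ k := by simp [hbox]
    rw [← h2, h1]
    refine (Finset.sum_le_card_nsmul _ _ _ hR).trans ?_
    simp [hB, mul_comm]
  have hinj : Set.InjOn (fun (X : Fin k → ℕ) j => (X j : ZMod q)) B := by
    intro X hX Y hY hXY
    have hX' := (Finset.mem_filter.1 (Finset.mem_coe.1 hX)).1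
    have hY' := (Finset.mem_filter.1 (Finset.mem_coe.1 hY)).1
    funext j
    have h := congrFun hXY j
    rw [ZMod.natCast_eq_natCast_iff] at h
    exact h.eq_of_lt_of_lt ((hmem X hX' j).trans_le hdq) ((hmem Y hY' j).trans_le hdq)
  refine ⟨B.image fun X j => (X j : ZMod q), ?_, ?_⟩
  · intro x hx y hy hxy i
    choose X hXB hX using fun i => Finset.mem_image.1 (hx i)
    obtain ⟨Y, hYB, rfl⟩ := Finset.mem_image.1 hy
    have hXb : ∀ i, X i ∈ box := fun i => (Finset.mem_filter.1 (hXB i)).1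
    have hYb : Y ∈ box := (Finset.mem_filter.1 hYB).1
    have hsum : ∀ j, ∑ i, X i j = n * Y j := by
      intro j
      have h := congrFun hxy j
      simp only [Finset.sum_apply, ← hX, Pi.smul_apply, nsmul_eq_mul] at h
      have h' : ((∑ i, X i j : ℕ) : ZMod q) = ((n * Y j : ℕ) : ZMod q) := by
        push_cast
        exact h
      rw [ZMod.natCast_eq_natCast_iff] at h'
      refine h'.eq_of_lt_of_lt (lt_of_le_of_lt ?_ hq) (lt_of_le_of_lt ?_ hq)
      · calc ∑ i, X i j ≤ ∑ _i : Fin n, (d - 1) :=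
              Finset.sum_le_sum fun i _ => Nat.le_sub_one_of_lt (hmem _ (hXb i) j)
          _ = n * (d - 1) := by simp
      · exact Nat.mul_le_mul_left _ (Nat.le_sub_one_of_lt (hmem _ hYb j))
    have := eq_of_sum_eq_of_sum_sq_eq (R : ℤ) (fun i j => (X i j : ℤ)) (fun j => (Y j : ℤ))
      (fun i => by exact_mod_cast (Finset.mem_filter.1 (hXB i)).2)
      (by exact_mod_cast (Finset.mem_filter.1 hYB).2)
      (fun j => by exact_mod_cast hsum j) i
    rw [← hX i]
    funext j
    have h := this j
    simp only [Nat.cast_inj] at h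
    simp [h]
  · rwa [Finset.card_image_of_injOn hinj]

/-- A set without nontrivial averages in a field of `q ^ k` elements. The field is used only to
have a vector space of dimension `k` over `ZMod q` in which linear algebra is one-dimensional. -/
lemma exists_field_averageFree {n k q : ℕ} (hn : 1 ≤ n) (hk : 1 ≤ k) (hq : q.Prime) :
    ∃ (F : Type) (_ : Field F) (_ : Fintype F) (S : Finset F), Fintype.card F = q ^ k ∧
      AverageFree n S ∧ q ^ k ≤ S.card * (k * q ^ 2) * n ^ k := by
  have : Fact q.Prime := ⟨hq⟩
  -- The largest `d` with `n * (d - 1) < q`; it satisfies `q ≤ n * d` and `d ≤ q`.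
  set d := (q - 1) / n + 1 with hd
  have hq1 : 1 ≤ q := hq.one_lt.le
  have h1 : n * (d - 1) < q := by
    have := Nat.mul_div_le (q - 1) n
    simp only [hd, Nat.add_sub_cancel]
    omega
  have h2 : q ≤ n * d := by
    have := Nat.lt_mul_div_succ (q - 1) (show 0 < n by omega)
    rw [hd]
    omega
  have h3 : d ≤ q := by
    have := Nat.div_le_self (q - 1) n
    omega
  obtain ⟨S, hS, hcard⟩ := exists_averageFree_pi (k := k) hn hk (Nat.le_add_left 1 _) h1
  have hfin : Module.finrank (ZMod q) (Fin k → ZMod q)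
      = Module.finrank (ZMod q) (GaloisField q k) := by
    rw [GaloisField.finrank q (by omega)]
    simp
  let e := (LinearEquiv.ofFinrankEq (Fin k → ZMod q) (GaloisField q k) hfin).toAddEquiv
  let _ : Fintype (GaloisField q k) := Fintype.ofFinite _
  refine ⟨GaloisField q k, inferInstance, inferInstance, _, ?_, hS.map e, ?_⟩
  · rw [← Nat.card_eq_fintype_card]
    exact GaloisField.card q k (by omega)
  · rw [Finset.card_map]
    calc q ^ k ≤ (n * d) ^ k := Nat.pow_le_pow_left h2 k
      _ = d ^ k * n ^ k := by rw [mul_pow, mul_comm]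
      _ ≤ S.card * (k * d ^ 2) * n ^ k := Nat.mul_le_mul_right _ hcard
      _ ≤ S.card * (k * q ^ 2) * n ^ k := by gcongr

/-! ### Counting weights with prescribed sums on colour classes -/

section ColorSum

variable {C V F : Type*} [Fintype C] [DecidableEq C] [Fintype V] [DecidableEq V] [Field F]

variable (F) in
/-- The linear map sending a weight `w : V → F` to its sums over the colour classes of `A`. -/
def colorSum (A : V → C) : (V → F) →ₗ[F] (C → F) where
  toFun w c := ∑ v with A v = c, w v
  map_add' w w' := by
    funext c
    simp [Finset.sum_add_distrib]
  map_smul' a w := by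
    funext c
    simp [Finset.mul_sum]

omit [Fintype C] [DecidableEq V] in
lemma colorSum_apply (A : V → C) (w : V → F) (c : C) :
    colorSum F A w c = ∑ v with A v = c, w v := rfl

omit [Fintype C] in
lemma colorSum_single (A : V → C) (v : V) :
    colorSum F A (Pi.single v 1) = Pi.single (A v) 1 := by
  funext c
  rw [colorSum_apply, Finset.sum_filter]
  by_cases h : A v = c
  · subst h
    rw [Finset.sum_eq_single v] <;> simp +contextual
  · rw [Finset.sum_eq_zero]
    · simp [Ne.symm h]
    · intro x _
      by_cases hx : x = v
      · subst hx
        simp [h]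
      · simp [hx]

omit [DecidableEq V] in
lemma sum_colorSum (A : V → C) (w : V → F) : ∑ c, colorSum F A w c = ∑ v, w v := by
  simp only [colorSum_apply]
  exact Finset.sum_fiberwise _ _ _

lemma colorSum_surjective {A : V → C} (hA : Function.Surjective A) :
    Function.Surjective (colorSum F A) := by
  rw [← LinearMap.range_eq_top, eq_top_iff, ← (Pi.basisFun F C).span_eq, Submodule.span_le]
  rintro _ ⟨c, rfl⟩
  obtain ⟨v, rfl⟩ := hA c
  exact ⟨Pi.single v 1, by simp [colorSum_single]⟩

omit [Fintype V] [DecidableEq V] in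
/-- A nonempty fibre of a linear map is a coset of the kernel. -/
lemma card_fiber_eq_card_ker {M N : Type*} [AddCommGroup M] [Module F M] [AddCommGroup N]
    [Module F N] [Fintype M] [DecidableEq N] (L : M →ₗ[F] N) (w₀ : M) :
    (Finset.univ.filter fun w => L w = L w₀).card = Nat.card (LinearMap.ker L) := by
  rw [← Nat.subtype_card (p := fun w => L w = L w₀) (Finset.univ.filter fun w => L w = L w₀)
    (by simp)]
  refine Nat.card_congr
    { toFun := fun w => ⟨w.1 - w₀, by simp [w.2]⟩
      invFun := fun w => ⟨w.1 + w₀, by simp [LinearMap.mem_ker.1 w.2]⟩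
      left_inv := fun w => by simp
      right_inv := fun w => by simp }

variable [Fintype F] [DecidableEq F]

/-- Weights with prescribed sums on the classes of one surjective colouring. -/
lemma card_colorSum_eq {A : V → C} (hA : Function.Surjective A) (s : C → F) :
    (Finset.univ.filter fun w : V → F => colorSum F A w = s).card
      * Fintype.card F ^ Fintype.card C = Fintype.card F ^ Fintype.card V := by
  obtain ⟨w₀, rfl⟩ := colorSum_surjective (F := F) hA s
  have h := (colorSum F A).finrank_range_add_finrank_ker
  rw [LinearMap.range_eq_top.2 (colorSum_surjective hA), finrank_top, Module.finrank_pi,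
    Module.finrank_pi] at h
  rw [card_fiber_eq_card_ker, Module.natCard_eq_pow_finrank (K := F), Nat.card_eq_fintype_card,
    ← pow_add, ← h, add_comm]

lemma card_sum_eq_zero [Nonempty V] :
    (Finset.univ.filter fun w : V → F => ∑ v, w v = 0).card * Fintype.card F
      = Fintype.card F ^ Fintype.card V := by
  have h := card_colorSum_eq (A := fun _ : V => ()) (fun _ => ⟨Classical.arbitrary V, rfl⟩)
    (0 : Unit → F)
  rw [Fintype.card_unit, pow_one] at h
  rw [← h]
  congr 3
  ext w
  simp [funext_iff, colorSum_apply]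

/-- Weights with prescribed sums on the classes of two colourings `A` and `B` that agree on a
system of representatives `u`. The rank of this system of `2 * card C` linear equations is computed
from its transpose, whose kernel consists of the `α : C → F` with `α ∘ A = α ∘ B`. -/
lemma card_colorSum_pair_le {A B : V → C} {u : C → V} (hA : ∀ c, A (u c) = c)
    (hB : ∀ c, B (u c) = c) (s s' : C → F) :
    (Finset.univ.filter fun w : V → F => colorSum F A w = s ∧ colorSum F B w = s').card
      * Fintype.card F ^ (2 * Fintype.card C)
      ≤ Fintype.card F ^ Fintype.card V
        * (Finset.univ.filter fun α : C → F => α ∘ A = α ∘ B).card := by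
  set L := (colorSum F A).prod (colorSum F B) with hL
  -- Relations among the equations: their first halves lie in the space on the right.
  have hdual : Nat.card (LinearMap.ker L.dualMap)
      ≤ (Finset.univ.filter fun α : C → F => α ∘ A = α ∘ B).card := by
    rw [← Nat.subtype_card (p := fun α : C → F => α ∘ A = α ∘ B) _ (by simp)]
    have hrel : ∀ φ ∈ LinearMap.ker L.dualMap, ∀ v,
        φ (Pi.single (A v) 1, 0) + φ (0, Pi.single (B v) 1) = 0 := by
      intro φ hφ v
      have h := LinearMap.congr_fun (LinearMap.mem_ker.1 hφ) (Pi.single v 1)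
      rw [← map_add]
      simpa [hL, colorSum_single] using h
    have hu : ∀ φ ∈ LinearMap.ker L.dualMap, ∀ c,
        φ (0, Pi.single c 1) = - φ (Pi.single c 1, 0) := by
      intro φ hφ c
      have h := hrel φ hφ (u c)
      rw [hA, hB] at h
      exact (neg_eq_of_add_eq_zero_right h).symm
    refine Nat.card_le_card_of_injective
      (fun φ => ⟨fun c => φ.1 (Pi.single c 1, 0), ?_⟩) ?_
    · funext v
      have h := hrel φ.1 φ.2 v
      rw [hu φ.1 φ.2] at h
      exact add_neg_eq_zero.1 h
    · intro φ ψ h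
      have h' : ∀ c, φ.1 (Pi.single c 1, 0) = ψ.1 (Pi.single c 1, 0) :=
        fun c => congrFun (Subtype.ext_iff.1 h) c
      apply Subtype.ext
      apply LinearMap.prod_ext
      · refine LinearMap.pi_ext' fun c => LinearMap.ext_ring ?_
        simpa using h' c
      · refine LinearMap.pi_ext' fun c => LinearMap.ext_ring ?_
        simpa [hu φ.1 φ.2, hu ψ.1 ψ.2] using h' c
  have hfib : (Finset.univ.filter fun w : V → F => colorSum F A w = s ∧ colorSum F B w = s').card
      ≤ Nat.card (LinearMap.ker L) := by
    rcases Finset.eq_empty_or_nonempty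
      (Finset.univ.filter fun w : V → F => colorSum F A w = s ∧ colorSum F B w = s') with h | h
    · rw [h]
      simp
    · obtain ⟨w₀, hw₀⟩ := h
      obtain ⟨rfl, rfl⟩ := (Finset.mem_filter.1 hw₀).2
      rw [← card_fiber_eq_card_ker L w₀]
      refine le_of_eq (congrArg _ ?_)
      ext w
      simp [hL]
  have h1 := L.finrank_range_add_finrank_ker
  have h2 := L.dualMap.finrank_range_add_finrank_ker
  rw [LinearMap.finrank_range_dualMap_eq_finrank_range, Subspace.dual_finrank_eq,
    Module.finrank_prod, Module.finrank_pi] at h2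
  rw [Module.finrank_pi] at h1
  rw [Module.natCard_eq_pow_finrank (K := F), Nat.card_eq_fintype_card] at hfib hdual
  calc _ ≤ Fintype.card F ^ Module.finrank F (LinearMap.ker L)
        * Fintype.card F ^ (2 * Fintype.card C) := Nat.mul_le_mul_right _ hfib
    _ = Fintype.card F ^ Fintype.card V
        * Fintype.card F ^ Module.finrank F (LinearMap.ker L.dualMap) := by
      rw [← pow_add, ← pow_add]
      congr 1
      omega
    _ ≤ _ := Nat.mul_le_mul_left _ hdual

end ColorSum

/-! ### Colourings close to a given one -/

/-- Consequence of the convexity of `x * log x`: the chord of this function over `[1, n]` lies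
above its graph. Here `β` is `n ^ (n / (n - 1))`, or any number at least `1` if `n = 1`. -/
lemma pow_self_le_pow_pred {n : ℕ} {β : ℝ} (hβ : 1 ≤ β) (hβn : β ^ (n - 1) = (n : ℝ) ^ n)
    {a : ℕ} (ha : 1 ≤ a) (han : a ≤ n) : (a : ℝ) ^ a ≤ β ^ (a - 1) := by
  rcases Nat.lt_or_ge n 2 with hn | hn
  · obtain rfl : a = 1 := by omega
    simp
  have hβ0 : 0 < β := by linarith
  have ha0 : (0 : ℝ) < a := by exact_mod_cast ha
  have hn0 : (0 : ℝ) < n := by exact_mod_cast (by omega : 0 < n)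
  have hlogβ : ((n : ℝ) - 1) * Real.log β = n * Real.log n := by
    have h := congrArg Real.log hβn
    rw [Real.log_pow, Real.log_pow, Nat.cast_sub (by omega)] at h
    simpa using h
  rw [← Real.log_le_log_iff (by positivity) (by positivity), Real.log_pow, Real.log_pow,
    Nat.cast_sub ha, Nat.cast_one]
  have hn1 : (0 : ℝ) < (n : ℝ) - 1 := by
    have : (2 : ℝ) ≤ n := by exact_mod_cast hn
    linarith
  have ha1 : (1 : ℝ) ≤ a := by exact_mod_cast ha
  have han' : (a : ℝ) ≤ n := by exact_mod_cast han
  have hconv := Real.convexOn_mul_log.2 (show (1 : ℝ) ∈ Set.Ici 0 by simp)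
    (show (n : ℝ) ∈ Set.Ici 0 from hn0.le)
    (show 0 ≤ ((n : ℝ) - a) / (n - 1) from div_nonneg (by linarith) hn1.le)
    (show 0 ≤ ((a : ℝ) - 1) / (n - 1) from div_nonneg (by linarith) hn1.le)
    (by field_simp; ring)
  have hx : ((n : ℝ) - a) / (n - 1) * 1 + ((a : ℝ) - 1) / (n - 1) * n = a := by
    field_simp
    ring
  simp only [smul_eq_mul, hx, Real.log_one, mul_zero, zero_add] at hconv
  calc (a : ℝ) * Real.log a ≤ ((a : ℝ) - 1) / (n - 1) * (n * Real.log n) := hconv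
    _ = ((a : ℝ) - 1) * Real.log β := by
      rw [← hlogβ]
      field_simp

/-- The product over `J` of the sizes of the level sets of `α`. -/
lemma prod_card_level_le {C F : Type*} [DecidableEq F] (J : Finset C) (α : C → F)
    {β : ℝ} (h : ∀ a : ℕ, 1 ≤ a → a ≤ J.card → (a : ℝ) ^ a ≤ β ^ (a - 1)) :
    ∏ j ∈ J, ((J.filter fun j' => α j' = α j).card : ℝ) ≤ β ^ (J.card - (J.image α).card) := by
  have hpos : ∀ x ∈ J.image α, 1 ≤ (J.filter fun j' => α j' = x).card := by
    intro x hx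
    obtain ⟨j, hj, rfl⟩ := Finset.mem_image.1 hx
    exact Finset.card_pos.2 ⟨j, by simp [hj]⟩
  have hsum : ∑ x ∈ J.image α, ((J.filter fun j' => α j' = x).card - 1)
      = J.card - (J.image α).card := by
    rw [Finset.sum_tsub_distrib _ hpos, ← Finset.card_eq_sum_card_image]
    simp
  calc ∏ j ∈ J, ((J.filter fun j' => α j' = α j).card : ℝ)
      = ∏ x ∈ J.image α, ((J.filter fun j' => α j' = x).card : ℝ)
          ^ (J.filter fun j' => α j' = x).card :=
        Finset.prod_comp (fun x => ((J.filter fun j' => α j' = x).card : ℝ)) α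
    _ ≤ ∏ x ∈ J.image α, β ^ ((J.filter fun j' => α j' = x).card - 1) :=
        Finset.prod_le_prod (fun _ _ => by positivity)
          fun x hx => h _ (hpos x hx) (Finset.card_le_card (Finset.filter_subset _ _))
    _ = _ := by rw [Finset.prod_pow_eq_pow_sum, hsum]

section Near

variable {n r : ℕ} {V F : Type*} [Fintype V] [DecidableEq V] [Fintype F] [DecidableEq F]

/-- The colourings `B ≠ A` with the same class of colour `i` as `A`. -/
def nearColorings (A : V → Fin (n + 1)) (i : Fin (n + 1)) : Finset (V → Fin (n + 1)) :=
  Finset.univ.filter fun B => B ≠ A ∧ ∀ v, B v = i ↔ A v = i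

omit [Fintype F] in
lemma card_near_comp_eq_le {A : V → Fin (n + 1)}
    (hA : ∀ c, (Finset.univ.filter fun v => A v = c).card = r) (i : Fin (n + 1))
    {β : ℝ} (hβ : 1 ≤ β) (h : ∀ a : ℕ, 1 ≤ a → a ≤ n → (a : ℝ) ^ a ≤ β ^ (a - 1))
    (α : Fin (n + 1) → F) :
    (((nearColorings A i).filter fun B => α ∘ A = α ∘ B).card : ℝ)
      ≤ (β ^ r) ^ (n + 1 - (Finset.univ.image α).card) := by
  set J := Finset.univ.erase i with hJ
  have hJcard : J.card = n := by simp [hJ]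
  set g : Fin (n + 1) → Finset (Fin (n + 1)) :=
    fun c => if c = i then {i} else J.filter fun j' => α j' = α c with hg
  have hsub : ((nearColorings A i).filter fun B => α ∘ A = α ∘ B)
      ⊆ Fintype.piFinset fun v => g (A v) := by
    intro B hB
    simp only [nearColorings, Finset.mem_filter, Finset.mem_univ, true_and] at hB
    rw [Fintype.mem_piFinset]
    intro v
    by_cases hv : A v = i
    · simp [hg, hv, (hB.1.2 v).2 hv]
    · have hBv : B v ≠ i := fun h => hv ((hB.1.2 v).1 h)
      simpa [hg, hv, hJ, hBv] using (congrFun hB.2 v).symm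
  have hprod : ∏ v, ((g (A v)).card : ℝ)
      = (∏ j ∈ J, ((J.filter fun j' => α j' = α j).card : ℝ)) ^ r := by
    rw [← Finset.prod_fiberwise Finset.univ A, ← Finset.prod_pow,
      ← Finset.mul_prod_erase _ _ (Finset.mem_univ i)]
    have h1 : ∀ c, ∏ v with A v = c, ((g (A v)).card : ℝ) = ((g c).card : ℝ) ^ r := by
      intro c
      rw [← hA c, Finset.prod_congr rfl (g := fun _ => ((g c).card : ℝ)), Finset.prod_const]
      intro v hv
      rw [(Finset.mem_filter.1 hv).2]
    simp only [h1]
    rw [show g i = {i} from if_pos rfl, Finset.card_singleton, Nat.cast_one, one_pow, one_mul]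
    refine Finset.prod_congr rfl fun j hj => ?_
    rw [show g j = J.filter fun j' => α j' = α j from if_neg (Finset.ne_of_mem_erase hj)]
  have himage : (Finset.univ.image α).card ≤ (J.image α).card + 1 := by
    have : Finset.univ.image α ⊆ insert (α i) (J.image α) := by
      rw [← Finset.image_insert, hJ, Finset.insert_erase (Finset.mem_univ i)]
    exact (Finset.card_le_card this).trans (Finset.card_insert_le _ _)
  calc (((nearColorings A i).filter fun B => α ∘ A = α ∘ B).card : ℝ)
      ≤ ((Fintype.piFinset fun v => g (A v)).card : ℝ) := by
        exact_mod_cast Finset.card_le_card hsub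
    _ = (∏ j ∈ J, ((J.filter fun j' => α j' = α j).card : ℝ)) ^ r := by
        rw [Fintype.card_piFinset, Nat.cast_prod, hprod]
    _ ≤ (β ^ (J.card - (J.image α).card)) ^ r :=
        pow_le_pow_left₀ (Finset.prod_nonneg fun _ _ => Nat.cast_nonneg _)
          (prod_card_level_le J α (by rwa [hJcard])) r
    _ = (β ^ r) ^ (J.card - (J.image α).card) := by rw [← pow_mul, ← pow_mul, mul_comm]
    _ ≤ _ := pow_le_pow_right₀ (one_le_pow₀ hβ) (by omega)

lemma card_image_card_eq_le {C : Type*} [Fintype C] [DecidableEq C] (k : ℕ) :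
    (Finset.univ.filter fun α : C → F => (Finset.univ.image α).card = k).card
      ≤ k ^ Fintype.card C * Fintype.card F ^ k := by
  have : (Finset.univ.filter fun α : C → F => (Finset.univ.image α).card = k)
      ⊆ Finset.univ.image fun x : (C → Fin k) × (Fin k → F) => x.2 ∘ x.1 := by
    intro α hα
    have e := Finset.equivFinOfCardEq (Finset.mem_filter.1 hα).2
    rw [Finset.mem_image]
    exact ⟨(fun c => e ⟨α c, by simp⟩, fun j => (e.symm j).1), by simp, by ext c; simp⟩
  refine (Finset.card_le_card this).trans (Finset.card_image_le.trans ?_)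
  simp

/-- The second-moment estimate. An injective `α` contributes nothing since `α ∘ A = α ∘ B` forces
`B = A`; for `α` with `k ≤ n` values, the `card F ^ k` choices of its values are outweighed by
the bound on the number of `B`, because `β ^ r ≤ card F`. -/
lemma sum_near_le {A : V → Fin (n + 1)}
    (hA : ∀ c, (Finset.univ.filter fun v => A v = c).card = r) (i : Fin (n + 1))
    {β : ℝ} (hβ : 1 ≤ β) (h : ∀ a : ℕ, 1 ≤ a → a ≤ n → (a : ℝ) ^ a ≤ β ^ (a - 1))
    (hF : β ^ r ≤ Fintype.card F) :
    ∑ B ∈ nearColorings A i,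
      ((Finset.univ.filter fun α : Fin (n + 1) → F => α ∘ A = α ∘ B).card : ℝ)
      ≤ (n + 1 : ℝ) ^ (n + 2) * (β ^ r * (Fintype.card F : ℝ) ^ n) := by
  set p : ℝ := (Fintype.card F : ℝ) with hp
  have hm : 1 ≤ β ^ r := one_le_pow₀ hβ
  have hswap : ∑ B ∈ nearColorings A i,
      ((Finset.univ.filter fun α : Fin (n + 1) → F => α ∘ A = α ∘ B).card : ℝ)
      = ∑ α : Fin (n + 1) → F, (((nearColorings A i).filter fun B => α ∘ A = α ∘ B).card : ℝ) := by
    simp only [Finset.card_filter, Nat.cast_sum]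
    exact Finset.sum_comm
  have hpart : ∑ α : Fin (n + 1) → F,
        (((nearColorings A i).filter fun B => α ∘ A = α ∘ B).card : ℝ)
      = ∑ k ∈ Finset.range (n + 2), ∑ α : Fin (n + 1) → F with (Finset.univ.image α).card = k,
        (((nearColorings A i).filter fun B => α ∘ A = α ∘ B).card : ℝ) := by
    refine (Finset.sum_fiberwise_of_maps_to (fun α _ => ?_) _).symm
    rw [Finset.mem_range, Nat.lt_succ_iff]
    exact Finset.card_image_le.trans (by simp)
  have hinj : ∑ α : Fin (n + 1) → F with (Finset.univ.image α).card = n + 1,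
      (((nearColorings A i).filter fun B => α ∘ A = α ∘ B).card : ℝ) = 0 := by
    refine Finset.sum_eq_zero fun α hα => ?_
    have hα' : Function.Injective α := by
      rw [← Finset.card_image_iff.trans (by simp [Set.injOn_univ] :
        Set.InjOn α ((Finset.univ : Finset (Fin (n + 1))) : Set _) ↔ Function.Injective α)]
      simpa using (Finset.mem_filter.1 hα).2
    rw [Nat.cast_eq_zero, Finset.card_eq_zero, Finset.filter_eq_empty_iff]
    intro B hB hAB
    exact (Finset.mem_filter.1 hB).2.1 (hα'.comp_left hAB).symm
  have hterm : ∀ k ∈ Finset.range (n + 1),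
      ∑ α : Fin (n + 1) → F with (Finset.univ.image α).card = k,
        (((nearColorings A i).filter fun B => α ∘ A = α ∘ B).card : ℝ)
      ≤ (n + 1 : ℝ) ^ (n + 1) * (β ^ r * p ^ n) := by
    intro k hk
    have hkn : k ≤ n := Nat.lt_succ_iff.1 (Finset.mem_range.1 hk)
    calc _ ≤ ∑ α : Fin (n + 1) → F with (Finset.univ.image α).card = k,
            (β ^ r) ^ (n + 1 - k) := by
          refine Finset.sum_le_sum fun α hα => ?_
          rw [← (Finset.mem_filter.1 hα).2]
          exact card_near_comp_eq_le hA i hβ h α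
      _ = ((Finset.univ.filter fun α : Fin (n + 1) → F =>
            (Finset.univ.image α).card = k).card : ℝ) * (β ^ r) ^ (n + 1 - k) := by
          rw [Finset.sum_const, nsmul_eq_mul]
      _ ≤ ((k : ℝ) ^ (n + 1) * p ^ k) * (β ^ r) ^ (n + 1 - k) := by
          gcongr
          have := card_image_card_eq_le (F := F) (C := Fin (n + 1)) k
          rw [Fintype.card_fin] at this
          rw [hp]
          exact_mod_cast this
      _ = (k : ℝ) ^ (n + 1) * (p ^ k * ((β ^ r) ^ (n - k) * β ^ r)) := by
          rw [← pow_succ, show n - k + 1 = n + 1 - k by omega, mul_assoc]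
      _ ≤ (n + 1 : ℝ) ^ (n + 1) * (p ^ k * (p ^ (n - k) * β ^ r)) := by
          gcongr
          exact_mod_cast hkn.trans (Nat.le_succ n)
      _ = (n + 1 : ℝ) ^ (n + 1) * (β ^ r * p ^ n) := by
          rw [← mul_assoc (p ^ k), ← pow_add, Nat.add_sub_cancel' hkn, mul_comm (p ^ n)]
  rw [hswap, hpart, Finset.sum_range_succ, hinj, add_zero]
  refine (Finset.sum_le_card_nsmul _ _ _ hterm).trans (le_of_eq ?_)
  rw [Finset.card_range, nsmul_eq_mul]
  push_cast
  ring

end Near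

/-! ### Selecting isolated colourings by a weight -/

section Isolated

variable {n : ℕ} {V F : Type*} [Fintype V] [DecidableEq V]

/-- The colourings with all classes of size `r` in which `u c` has colour `c`. -/
def balancedColorings (r : ℕ) (u : Fin (n + 1) → V) : Finset (V → Fin (n + 1)) :=
  Finset.univ.filter fun A =>
    (∀ c, (Finset.univ.filter fun v => A v = c).card = r) ∧ ∀ c, A (u c) = c

variable [Field F]

/-- The class sums required of a selected colouring: `s` on the nonzero colours, and the value
making the total zero on colour `0`. -/
def targetSums (n : ℕ) (s : F) : Fin (n + 1) → F := Fin.cons (-(n • s)) fun _ => s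

lemma sum_targetSums (s : F) : ∑ c, targetSums n s c = 0 := by
  simp [targetSums, Fin.sum_univ_succ]

lemma targetSums_injective (hn : 1 ≤ n) : Function.Injective (targetSums n : F → _) := by
  intro s s' h
  exact congrFun h (Fin.succ ⟨0, hn⟩)

/-- If every entry of `x` is the corresponding entry of some `targetSums n s` with `s ∈ S`, and
the entries of `x` add up to zero, then a single `s` serves for all of them. -/
lemma AverageFree.eq_targetSums {S : Finset F} (hS : AverageFree n S) {x : Fin (n + 1) → F}
    {s : Fin (n + 1) → F} (hs : ∀ c, s c ∈ S) (hx : ∀ c, x c = targetSums n (s c) c)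
    (hsum : ∑ c, x c = 0) (c : Fin (n + 1)) : s c = s 0 := by
  have h0 : x 0 = -(n • s 0) := hx 0
  have hsucc : ∀ i : Fin n, x i.succ = s i.succ := fun i => hx i.succ
  rw [Fin.sum_univ_succ, h0] at hsum
  simp only [hsucc] at hsum
  refine Fin.cases rfl (fun i => ?_) c
  exact hS (fun i => s i.succ) (fun i => hs _) (s 0) (hs 0) (neg_add_eq_zero.1 hsum).symm i

variable [DecidableEq F]

/-- The balanced colourings selected by the weight `w`. -/
def hashedColorings (r : ℕ) (u : Fin (n + 1) → V) (S : Finset F) (w : V → F) :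
    Finset (V → Fin (n + 1)) :=
  (balancedColorings r u).filter fun A => ∃ s ∈ S, colorSum F A w = targetSums n s

/-- The selected colourings that share no colour class with another selected colouring. -/
def isolatedColorings (r : ℕ) (u : Fin (n + 1) → V) (S : Finset F) (w : V → F) :
    Finset (V → Fin (n + 1)) :=
  (hashedColorings r u S w).filter fun A =>
    ∀ B ∈ hashedColorings r u S w, ∀ c, (∀ v, B v = c ↔ A v = c) → B = A

/-- A balanced colouring whose classes are taken from isolated colourings is selected itself, hence
equal to each of them. -/
lemma eq_of_mem_isolatedColorings {r : ℕ} {u : Fin (n + 1) → V} {S : Finset F} {w : V → F}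
    (hS : AverageFree n S) {Q : V → Fin (n + 1)} (hQ : Q ∈ balancedColorings r u)
    {P : Fin (n + 1) → V → Fin (n + 1)} (hP : ∀ c, P c ∈ isolatedColorings r u S w)
    (hQP : ∀ c v, Q v = c ↔ P c v = c) (c : Fin (n + 1)) : P c = Q := by
  have hK : ∀ c, P c ∈ hashedColorings r u S w := fun c => (Finset.mem_filter.1 (hP c)).1
  choose s hs hsum using fun c => (Finset.mem_filter.1 (hK c)).2
  have hx : ∀ c, colorSum F Q w c = targetSums n (s c) c := by
    intro c
    rw [← hsum c, colorSum_apply, colorSum_apply]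
    simp only [hQP c]
  have htot : ∑ c, colorSum F Q w c = 0 := by
    rw [sum_colorSum, ← sum_colorSum (P 0), hsum, sum_targetSums]
  have hQK : Q ∈ hashedColorings r u S w := by
    refine Finset.mem_filter.2 ⟨hQ, s 0, hs 0, ?_⟩
    funext c
    rw [hx, hS.eq_targetSums hs hx htot]
  exact ((Finset.mem_filter.1 (hP c)).2 Q hQK c (hQP c)).symm

omit [DecidableEq F] in
/-- Selected colourings with a common class have the same parameter `s`. -/
lemma eq_of_targetSums_eq (hn : 1 ≤ n) {S : Finset F} (hS : AverageFree n S) {s s' : F}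
    (hs : s ∈ S) (hs' : s' ∈ S) {c : Fin (n + 1)} (h : targetSums n s c = targetSums n s' c) :
    s = s' := by
  revert h
  refine Fin.cases (fun h => ?_) (fun i h => h) c
  refine hS (fun _ => s) (fun _ => hs) s' hs' ?_ ⟨0, hn⟩
  have h' : n • s = n • s' := neg_injective h
  simpa using h'

variable [Fintype F]

/-- First-moment argument over all weights: the isolated colourings make up half of the selected
ones on average. Only weights with total zero select anything, which saves a factor `card F`. -/
lemma exists_card_isolatedColorings {r : ℕ} {u : Fin (n + 1) → V} (hn : 1 ≤ n) {S : Finset F}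
    (hS : AverageFree n S) {β : ℝ} (hβ : 1 ≤ β)
    (h : ∀ a : ℕ, 1 ≤ a → a ≤ n → (a : ℝ) ^ a ≤ β ^ (a - 1))
    (hF : 2 * (n + 1 : ℝ) ^ (n + 3) * β ^ r ≤ Fintype.card F) :
    ∃ w : V → F, ((balancedColorings r u).card : ℝ) * S.card
      ≤ 2 * (Fintype.card F : ℝ) ^ n * (isolatedColorings r u S w).card := by
  set p : ℝ := (Fintype.card F : ℝ) with hp
  set T := balancedColorings r u with hT
  set K := hashedColorings r u S with hK
  set I := isolatedColorings r u S with hI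
  have hp0 : 0 < p := by
    rw [hp]
    exact_mod_cast Fintype.card_pos
  have : Nonempty V := ⟨u 0⟩
  have hTu : ∀ A ∈ T, ∀ c, A (u c) = c := fun A hA => (Finset.mem_filter.1 hA).2.2
  have hTr : ∀ A ∈ T, ∀ c, (Finset.univ.filter fun v => A v = c).card = r :=
    fun A hA => (Finset.mem_filter.1 hA).2.1
  -- the expected number of selected colourings
  have hfirst : ∀ A ∈ T, ((Finset.univ.filter fun w => A ∈ K w).card : ℝ)
      = S.card * (p ^ Fintype.card V / p ^ (n + 1)) := by
    intro A hA
    have hset : (Finset.univ.filter fun w => A ∈ K w)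
        = S.biUnion fun s => Finset.univ.filter fun w => colorSum F A w = targetSums n s := by
      ext w
      simp [hK, hashedColorings, ← hT, hA]
    have hsurj : Function.Surjective A := fun c => ⟨u c, hTu A hA c⟩
    rw [hset, Finset.card_biUnion, Nat.cast_sum, Finset.sum_congr rfl
      (g := fun _ => p ^ Fintype.card V / p ^ (n + 1)), Finset.sum_const, nsmul_eq_mul]
    · intro s _
      rw [eq_div_iff (by positivity), hp]
      have := card_colorSum_eq hsurj (targetSums n s)
      rw [Fintype.card_fin] at this
      exact_mod_cast this
    · intro s _ s' _ hss
      refine Finset.disjoint_filter.2 fun w _ h1 h2 => ?_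
      exact hss (targetSums_injective hn (h1.symm.trans h2))
  -- the expected number of conflicts
  have hpair : ∀ A ∈ T, ∀ i, ∀ B ∈ nearColorings A i,
      ((Finset.univ.filter fun w => A ∈ K w ∧ B ∈ K w).card : ℝ)
      ≤ S.card * (p ^ Fintype.card V / p ^ (2 * (n + 1))) *
        (Finset.univ.filter fun α : Fin (n + 1) → F => α ∘ A = α ∘ B).card := by
    intro A hA i B hB
    by_cases hBT : B ∈ T
    · have hset : (Finset.univ.filter fun w => A ∈ K w ∧ B ∈ K w)
          ⊆ S.biUnion fun s => Finset.univ.filter fun w =>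
            colorSum F A w = targetSums n s ∧ colorSum F B w = targetSums n s := by
        intro w hw
        obtain ⟨hAw, hBw⟩ := (Finset.mem_filter.1 hw).2
        obtain ⟨s, hs, hAs⟩ := (Finset.mem_filter.1 hAw).2
        obtain ⟨s', hs', hBs⟩ := (Finset.mem_filter.1 hBw).2
        have hss : s = s' := by
          refine eq_of_targetSums_eq hn hS hs hs' (c := i) ?_
          rw [← hAs, ← hBs, colorSum_apply, colorSum_apply]
          simp only [(Finset.mem_filter.1 hB).2.2]
        subst hss
        simp only [Finset.mem_biUnion, Finset.mem_filter, Finset.mem_univ, true_and]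
        exact ⟨s, hs, hAs, hBs⟩
      have hle : ((Finset.univ.filter fun w => A ∈ K w ∧ B ∈ K w).card : ℝ)
          ≤ ∑ s ∈ S, ((Finset.univ.filter fun w =>
            colorSum F A w = targetSums n s ∧ colorSum F B w = targetSums n s).card : ℝ) := by
        exact_mod_cast (Finset.card_le_card hset).trans Finset.card_biUnion_le
      refine hle.trans ((Finset.sum_le_card_nsmul S _
        (p ^ Fintype.card V / p ^ (2 * (n + 1)) *
          (Finset.univ.filter fun α : Fin (n + 1) → F => α ∘ A = α ∘ B).card)
        fun s _ => ?_).trans (le_of_eq ?_))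
      · rw [div_mul_eq_mul_div, le_div_iff₀ (by positivity), hp]
        have := card_colorSum_pair_le (hTu A hA) (hTu B hBT) (targetSums n s) (targetSums n s)
        rw [Fintype.card_fin] at this
        exact_mod_cast this
      · rw [nsmul_eq_mul, mul_assoc]
    · rw [Finset.filter_false_of_mem, Finset.card_empty, Nat.cast_zero]
      · positivity
      · intro w _ hw
        exact hBT (Finset.mem_filter.1 hw.2).1
  have hconf : ∀ w, ((K w).card : ℝ) ≤ (I w).card
      + ∑ A ∈ T, ∑ i, ∑ B ∈ nearColorings A i, if A ∈ K w ∧ B ∈ K w then (1 : ℝ) else 0 := by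
    intro w
    have hsub : K w ⊆ I w ∪ T.biUnion fun A => Finset.univ.biUnion fun i =>
        (nearColorings A i).biUnion fun B => if A ∈ K w ∧ B ∈ K w then {A} else ∅ := by
      intro A hA
      by_cases hAI : A ∈ I w
      · exact Finset.mem_union_left _ hAI
      · apply Finset.mem_union_right
        simp only [hI, isolatedColorings, Finset.mem_filter, not_and, not_forall] at hAI
        obtain ⟨B, hB, c, hc, hne⟩ := hAI hA
        simp only [Finset.mem_biUnion]
        refine ⟨A, (Finset.mem_filter.1 hA).1, c, Finset.mem_univ _, B, ?_, ?_⟩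
        · exact Finset.mem_filter.2 ⟨Finset.mem_univ _, hne, hc⟩
        · rw [if_pos ⟨hA, hB⟩]
          exact Finset.mem_singleton_self A
    have hcard := (Finset.card_le_card hsub).trans (Finset.card_union_le _ _)
    have hb : (T.biUnion fun A => Finset.univ.biUnion fun i =>
        (nearColorings A i).biUnion fun B => if A ∈ K w ∧ B ∈ K w then {A} else ∅).card
        ≤ ∑ A ∈ T, ∑ i, ∑ B ∈ nearColorings A i, if A ∈ K w ∧ B ∈ K w then 1 else 0 := by
      refine Finset.card_biUnion_le.trans (Finset.sum_le_sum fun A _ => ?_)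
      refine Finset.card_biUnion_le.trans (Finset.sum_le_sum fun i _ => ?_)
      refine Finset.card_biUnion_le.trans (Finset.sum_le_sum fun B _ => ?_)
      split_ifs <;> simp
    exact_mod_cast hcard.trans (Nat.add_le_add_left hb _)
  have hcount : ∀ q : (V → F) → Prop, ∀ [DecidablePred q],
      ∑ w, (if q w then (1 : ℝ) else 0) = (Finset.univ.filter q).card := by
    intro q _
    simp
  have hKsum : ∑ w, ((K w).card : ℝ)
      = T.card * (S.card * (p ^ Fintype.card V / p ^ (n + 1))) := by
    have : ∀ w, ((K w).card : ℝ) = ∑ A ∈ T, if A ∈ K w then (1 : ℝ) else 0 := by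
      intro w
      have hKT : K w ⊆ T := Finset.filter_subset _ _
      rw [Finset.sum_boole, Finset.filter_mem_eq_inter, Finset.inter_eq_right.2 hKT]
    simp only [this]
    rw [Finset.sum_comm]
    simp only [hcount]
    rw [Finset.sum_congr rfl hfirst, Finset.sum_const, nsmul_eq_mul]
  have hbad : ∑ w, ∑ A ∈ T, ∑ i, ∑ B ∈ nearColorings A i,
        (if A ∈ K w ∧ B ∈ K w then (1 : ℝ) else 0)
      ≤ (T.card * (S.card * (p ^ Fintype.card V / p ^ (n + 1)))) / 2 := by
    rw [Finset.sum_comm]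
    have hA : ∀ A ∈ T, ∑ w, ∑ i, ∑ B ∈ nearColorings A i,
        (if A ∈ K w ∧ B ∈ K w then (1 : ℝ) else 0)
        ≤ (S.card * (p ^ Fintype.card V / p ^ (n + 1))) / 2 := by
      intro A hA
      rw [Finset.sum_comm]
      have hi : ∀ i ∈ (Finset.univ : Finset (Fin (n + 1))), ∑ w, ∑ B ∈ nearColorings A i,
          (if A ∈ K w ∧ B ∈ K w then (1 : ℝ) else 0)
          ≤ S.card * (p ^ Fintype.card V / p ^ (2 * (n + 1))) *
            ((n + 1 : ℝ) ^ (n + 2) * (β ^ r * p ^ n)) := by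
        intro i _
        rw [Finset.sum_comm]
        simp only [hcount]
        refine (Finset.sum_le_sum (hpair A hA i)).trans ?_
        rw [← Finset.mul_sum]
        refine mul_le_mul_of_nonneg_left (sum_near_le (hTr A hA) i hβ h ?_) (by positivity)
        refine le_trans ?_ hF
        have h1 : (1 : ℝ) ≤ 2 * (n + 1 : ℝ) ^ (n + 3) := by
          have : (1 : ℝ) ≤ (n + 1 : ℝ) ^ (n + 3) := one_le_pow₀ (by simp)
          linarith
        exact le_mul_of_one_le_left (by positivity) h1
      refine (Finset.sum_le_card_nsmul _ _ _ hi).trans ?_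
      rw [Finset.card_univ, Fintype.card_fin, nsmul_eq_mul]
      have hfac : (n + 1 : ℝ) ^ (n + 3) * β ^ r ≤ p / 2 := by linarith
      calc ((n + 1 : ℕ) : ℝ) * (S.card * (p ^ Fintype.card V / p ^ (2 * (n + 1))) *
            ((n + 1 : ℝ) ^ (n + 2) * (β ^ r * p ^ n)))
          = S.card * (p ^ Fintype.card V / p ^ (2 * (n + 1))) * p ^ n *
            ((n + 1 : ℝ) ^ (n + 3) * β ^ r) := by
            push_cast
            ring
        _ ≤ S.card * (p ^ Fintype.card V / p ^ (2 * (n + 1))) * p ^ n * (p / 2) :=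
            mul_le_mul_of_nonneg_left hfac (by positivity)
        _ = (S.card * (p ^ Fintype.card V / p ^ (n + 1))) / 2 := by
            rw [two_mul, pow_add]
            field_simp
            ring
    refine (Finset.sum_le_card_nsmul _ _ _ hA).trans (le_of_eq ?_)
    rw [nsmul_eq_mul]
    ring
  have hmain : (T.card * (S.card * (p ^ Fintype.card V / p ^ (n + 1)))) / 2
      ≤ ∑ w, ((I w).card : ℝ) := by
    have := Finset.sum_le_sum fun w (_ : w ∈ Finset.univ) => hconf w
    rw [Finset.sum_add_distrib, hKsum] at this
    linarith
  set W₀ := Finset.univ.filter fun w : V → F => ∑ v, w v = 0 with hW₀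
  have hW₀card : (W₀.card : ℝ) * p = p ^ Fintype.card V := by
    rw [hp]
    exact_mod_cast card_sum_eq_zero (V := V) (F := F)
  have hIW₀ : ∑ w, ((I w).card : ℝ) = ∑ w ∈ W₀, ((I w).card : ℝ) := by
    symm
    refine Finset.sum_subset (Finset.subset_univ _) fun w _ hw => ?_
    rw [Nat.cast_eq_zero, Finset.card_eq_zero, Finset.eq_empty_iff_forall_notMem]
    intro A hA
    obtain ⟨s, -, hs⟩ := (Finset.mem_filter.1 (Finset.mem_filter.1 hA).1).2
    apply hw
    rw [hW₀, Finset.mem_filter, ← sum_colorSum A, hs, sum_targetSums]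
    exact ⟨Finset.mem_univ _, rfl⟩
  have hex : ∃ w ∈ W₀, (T.card : ℝ) * S.card ≤ 2 * p ^ n * (I w).card := by
    refine Finset.exists_le_of_sum_le ⟨0, by simp [hW₀]⟩ ?_
    rw [Finset.sum_const, nsmul_eq_mul, ← Finset.mul_sum, ← hIW₀]
    calc (W₀.card : ℝ) * (T.card * S.card)
        = 2 * p ^ n * ((T.card * (S.card * (W₀.card * p / p ^ (n + 1)))) / 2) := by
          rw [pow_succ]
          field_simp
      _ ≤ _ := by
          rw [hW₀card]
          exact mul_le_mul_of_nonneg_left hmain (by positivity)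
  obtain ⟨w, -, hw⟩ := hex
  exact ⟨w, hw⟩

end Isolated

/-! ### The number of balanced colourings -/

/-- A most frequent class-size profile of maps `Fin s → Fin (n + 1)`. -/
lemma exists_frequent_profile (n s : ℕ) : ∃ (ν : Fin (n + 1) → ℕ) (G : Finset (Fin s → Fin (n + 1))),
    (∀ g ∈ G, ∀ c, (Finset.univ.filter fun j => g j = c).card = ν c) ∧ ∑ c, ν c = s ∧
      (n + 1) ^ s ≤ G.card * (s + 1) ^ (n + 1) := by
  set f : (Fin s → Fin (n + 1)) → Fin (n + 1) → ℕ :=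
    fun g c => (Finset.univ.filter fun j => g j = c).card with hf
  set R : Finset (Fin (n + 1) → ℕ) := Fintype.piFinset fun _ => Finset.range (s + 1) with hR
  have hmaps : ∀ g ∈ (Finset.univ : Finset (Fin s → Fin (n + 1))), f g ∈ R := by
    intro g _
    rw [hR, Fintype.mem_piFinset]
    intro c
    rw [Finset.mem_range, Nat.lt_succ_iff]
    exact (Finset.card_filter_le _ _).trans (by simp)
  obtain ⟨ν, -, hν⟩ := Finset.exists_max_image (Finset.univ.image f)
    (fun ν => (Finset.univ.filter fun g => f g = ν).card)
    ⟨f fun _ => 0, Finset.mem_image_of_mem _ (Finset.mem_univ _)⟩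
  have hmax : ∀ ν' ∈ R, (Finset.univ.filter fun g => f g = ν').card
      ≤ (Finset.univ.filter fun g => f g = ν).card := by
    intro ν' _
    by_cases h : ν' ∈ Finset.univ.image f
    · exact hν ν' h
    · rw [Finset.filter_false_of_mem, Finset.card_empty]
      · exact Nat.zero_le _
      · rintro g - rfl
        exact h (Finset.mem_image_of_mem _ (Finset.mem_univ _))
  have hcard : (n + 1) ^ s ≤ (Finset.univ.filter fun g => f g = ν).card * (s + 1) ^ (n + 1) := by
    have h1 := Finset.card_eq_sum_card_fiberwise (f := f) (s := Finset.univ) (t := R)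
      fun g hg => hmaps g hg
    have h2 := Finset.sum_le_card_nsmul _ _ _ hmax
    rw [← h1] at h2
    simpa [hR, mul_comm] using h2
  refine ⟨ν, Finset.univ.filter fun g => f g = ν,
    fun g hg c => congrFun (Finset.mem_filter.1 hg).2 c, ?_, hcard⟩
  have hpos : 0 < (Finset.univ.filter fun g => f g = ν).card :=
    Nat.pos_of_mul_pos_right (lt_of_lt_of_le (by positivity) hcard)
  obtain ⟨g, hg⟩ := Finset.card_pos.1 hpos
  rw [← (Finset.mem_filter.1 hg).2]
  have := Finset.card_eq_sum_card_fiberwise (f := g) (s := Finset.univ) (t := Finset.univ)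
    (fun _ _ => Finset.mem_univ _)
  simpa [hf] using this.symm

/-- The number of balanced colourings is `(n + 1) ^ ((n + 1) * s)` up to a polynomial factor:
`n + 1` maps with the same profile of class sizes, cyclically shifted against each other, form
a balanced colouring. -/
lemma card_balancedColorings_ge (n s : ℕ) :
    (n + 1) ^ ((n + 1) * s) ≤
      (balancedColorings (s + 1) fun c : Fin (n + 1) => (c, (0 : Fin (s + 1)))).card
        * (s + 1) ^ ((n + 1) ^ 2) := by
  obtain ⟨ν, G, hG, hν, hcard⟩ := exists_frequent_profile n s
  have hle : G.card ^ (n + 1) ≤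
      (balancedColorings (s + 1) fun c : Fin (n + 1) => (c, (0 : Fin (s + 1)))).card := by
    have hpi : (Fintype.piFinset fun _ : Fin (n + 1) => G).card = G.card ^ (n + 1) := by simp
    rw [← hpi]
    refine Finset.card_le_card_of_injOn
      (fun h v => Fin.cases v.1 (fun j => h v.1 j + v.1) v.2) ?_ ?_
    · intro h hh
      have hh' : ∀ c, h c ∈ G := fun c => Fintype.mem_piFinset.1 hh c
      rw [balancedColorings, Finset.mem_coe, Finset.mem_filter]
      refine ⟨Finset.mem_univ _, fun x => ?_, fun c => rfl⟩
      rw [Finset.card_filter, Fintype.sum_prod_type]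
      simp only [Fin.sum_univ_succ (n := s), Fin.cases_zero, Fin.cases_succ]
      rw [Finset.sum_add_distrib]
      have h1 : ∑ c : Fin (n + 1), (if c = x then 1 else 0) = 1 := by simp
      have h2 : ∀ c : Fin (n + 1), ∑ j, (if h c j + c = x then 1 else 0) = ν (x - c) := by
        intro c
        rw [← hG (h c) (hh' c), Finset.card_filter]
        simp only [eq_sub_iff_add_eq]
      refine (congrArg₂ (· + ·) h1 (Finset.sum_congr rfl fun c _ => h2 c)).trans ?_
      have h3 : ∑ c, ν (x - c) = s := (Equiv.sum_comp (Equiv.subLeft x) ν).trans hν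
      simp only [h3, add_comm]
    · intro h _ h' _ hhh
      funext c j
      have := congrFun hhh (c, j.succ)
      simpa using this
  calc (n + 1) ^ ((n + 1) * s) = ((n + 1) ^ s) ^ (n + 1) := by rw [← pow_mul, mul_comm]
    _ ≤ (G.card * (s + 1) ^ (n + 1)) ^ (n + 1) := Nat.pow_le_pow_left hcard _
    _ = G.card ^ (n + 1) * (s + 1) ^ ((n + 1) ^ 2) := by rw [mul_pow, ← pow_mul, sq]
    _ ≤ _ := Nat.mul_le_mul_right _ hle

/-! ### From isolated colourings to matchings -/

/-- The hypergraph of all `r`-sets of vertices. -/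
def completeUniformHypergraph (V : Type) (r : ℕ) : UniformHypergraph V r :=
  ⟨{e | e.card = r}, fun _ he => he⟩

/-- The colour classes of a colouring. -/
def colorClasses {n : ℕ} {V : Type*} [Fintype V] [DecidableEq V] (P : V → Fin (n + 1)) :
    Finset (Finset V) :=
  Finset.univ.image fun c => Finset.univ.filter fun v => P v = c

section Matchings

variable {n r : ℕ} {V : Type} [Fintype V] [DecidableEq V] {u : Fin (n + 1) → V}

lemma isMatchingOfSize_colorClasses {P : V → Fin (n + 1)} (hP : P ∈ balancedColorings r u) :
    (completeUniformHypergraph V r).IsMatchingOfSize (n + 1) (colorClasses P) := by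
  obtain ⟨-, hr, hu⟩ := Finset.mem_filter.1 hP
  refine ⟨?_, ?_, ?_⟩
  · intro e he
    obtain ⟨c, -, rfl⟩ := Finset.mem_image.1 he
    exact hr c
  · rw [colorClasses, Finset.card_image_of_injective, Finset.card_univ, Fintype.card_fin]
    intro c c' h
    have := (Finset.ext_iff.1 h (u c)).1 (by simp [hu])
    simpa [hu] using this
  · intro e he e' he' hne
    obtain ⟨c, -, rfl⟩ := Finset.mem_image.1 he
    obtain ⟨c', -, rfl⟩ := Finset.mem_image.1 he'
    refine Finset.disjoint_filter.2 fun v _ h1 h2 => hne ?_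
    rw [← h1, ← h2]

/-- Disjoint classes have distinct colours since classes of the same colour `c` all contain `u c`.
So `n + 1` disjoint classes make up a balanced colouring, and isolation applies. -/
lemma eq_of_disjoint_colorClasses {F : Type*} [Field F] [DecidableEq F] {S : Finset F}
    {w : V → F} (hS : AverageFree n S) (hV : Fintype.card V = (n + 1) * r)
    {P : Fin (n + 1) → V → Fin (n + 1)} (hP : ∀ k, P k ∈ isolatedColorings r u S w)
    {e : Fin (n + 1) → Finset V} (he : ∀ k, e k ∈ colorClasses (P k))
    (hdisj : ∀ k l, k ≠ l → Disjoint (e k) (e l)) (k l : Fin (n + 1)) : P k = P l := by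
  have hbal : ∀ k, P k ∈ balancedColorings r u := fun k =>
    (Finset.mem_filter.1 (Finset.mem_filter.1 (hP k)).1).1
  have hr : ∀ k c, (Finset.univ.filter fun v => P k v = c).card = r := fun k =>
    (Finset.mem_filter.1 (hbal k)).2.1
  have hu : ∀ k c, P k (u c) = c := fun k => (Finset.mem_filter.1 (hbal k)).2.2
  choose σ _ hσ using fun k => Finset.mem_image.1 (he k)
  have hmem : ∀ k v, v ∈ e k ↔ P k v = σ k := fun k v => by rw [← hσ k]; simp
  have hinj : Function.Injective σ := by
    intro k l hkl
    by_contra hne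
    refine Finset.disjoint_left.1 (hdisj k l hne) ((hmem k (u (σ k))).2 (hu _ _)) ?_
    rw [hmem, hu, hkl]
  let τ := Equiv.ofBijective σ (Finite.injective_iff_bijective.1 hinj)
  have hστ : ∀ c, σ (τ.symm c) = c := fun c => τ.apply_symm_apply c
  have hcover : ∀ v, ∃ k, v ∈ e k := by
    have huniv : Finset.univ.biUnion e = Finset.univ := by
      rw [← Finset.card_eq_iff_eq_univ, Finset.card_biUnion fun k _ l _ => hdisj k l, hV]
      have : ∀ k, (e k).card = r := fun k => by rw [← hσ k, hr]
      simp [this]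
    intro v
    have := Finset.mem_univ v
    rw [← huniv] at this
    simpa using this
  choose κ hκ using hcover
  have hκ' : ∀ v k, v ∈ e k → κ v = k := by
    intro v k hv
    by_contra hne
    exact Finset.disjoint_left.1 (hdisj _ _ hne) (hκ v) hv
  have hQP : ∀ c v, σ (κ v) = c ↔ P (τ.symm c) v = c := by
    intro c v
    have h1 := hmem (τ.symm c) v
    rw [hστ] at h1
    rw [← h1]
    constructor
    · rintro rfl
      have : τ.symm (σ (κ v)) = κ v := τ.symm_apply_apply _
      rw [this]
      exact hκ v
    · intro hv
      rw [hκ' v _ hv, hστ]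
  have hQ : (fun v => σ (κ v)) ∈ balancedColorings r u := by
    refine Finset.mem_filter.2 ⟨Finset.mem_univ _, fun c => ?_, fun c => ?_⟩
    · simp only [hQP]
      exact hr _ c
    · exact (hQP c (u c)).2 (hu _ c)
  have hall := eq_of_mem_isolatedColorings hS hQ (P := fun c => P (τ.symm c))
    (fun c => hP _) hQP
  have hk : ∀ k, P k = fun v => σ (κ v) := by
    intro k
    have h1 := hall (σ k)
    have h2 : τ.symm (σ k) = k := τ.symm_apply_apply k
    rwa [h2] at h1
  rw [hk k, hk l]

end Matchings

/-- The matchings formed by the isolated colourings, with the bound on their number for a given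
field `F` and a given set `S`. -/
lemma exists_matchings_of_averageFree {n : ℕ} (hn : 1 ≤ n) (s : ℕ) {F : Type} [Field F]
    [Fintype F] {S : Finset F} (hS : AverageFree n S) {β : ℝ} (hβ : 1 ≤ β)
    (h : ∀ a : ℕ, 1 ≤ a → a ≤ n → (a : ℝ) ^ a ≤ β ^ (a - 1))
    (hF : 2 * (n + 1 : ℝ) ^ (n + 3) * β ^ (s + 1) ≤ Fintype.card F) :
    ∃ (N : ℕ) (M : Fin N → Finset (Finset (Fin (n + 1) × Fin (s + 1)))),
      (∀ j, (completeUniformHypergraph _ (s + 1)).IsMatchingOfSize (n + 1) (M j)) ∧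
      (∀ (j : Fin (n + 1) → Fin N) (e : Fin (n + 1) → Finset (Fin (n + 1) × Fin (s + 1))),
        (∀ k, e k ∈ M (j k)) → (∀ k l, k ≠ l → Disjoint (e k) (e l)) → ∀ k l, j k = j l) ∧
      ((n + 1 : ℝ) ^ ((n + 1) * s)) * S.card
        ≤ 2 * (Fintype.card F : ℝ) ^ n * N * (s + 1 : ℝ) ^ ((n + 1) ^ 2) := by
  classical
  set u : Fin (n + 1) → Fin (n + 1) × Fin (s + 1) := fun c => (c, 0) with hu
  obtain ⟨w, hw⟩ := exists_card_isolatedColorings (u := u) hn hS hβ h hF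
  set I := isolatedColorings (s + 1) u S w with hI
  let f := I.equivFin
  have hbal : ∀ j, (f.symm j).1 ∈ balancedColorings (s + 1) u := fun j =>
    (Finset.mem_filter.1 (Finset.mem_filter.1 (f.symm j).2).1).1
  refine ⟨I.card, fun j => colorClasses (f.symm j).1,
    fun j => isMatchingOfSize_colorClasses (hbal j), ?_, ?_⟩
  · intro j e he hdisj k l
    have := eq_of_disjoint_colorClasses hS (by simp) (P := fun k => (f.symm (j k)).1)
      (fun k => (f.symm (j k)).2) he hdisj k l
    exact f.symm.injective (Subtype.ext this)
  · have hT : ((n + 1 : ℝ) ^ ((n + 1) * s))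
        ≤ (balancedColorings (s + 1) u).card * (s + 1 : ℝ) ^ ((n + 1) ^ 2) := by
      exact_mod_cast card_balancedColorings_ge n s
    calc ((n + 1 : ℝ) ^ ((n + 1) * s)) * S.card
        ≤ ((balancedColorings (s + 1) u).card * (s + 1 : ℝ) ^ ((n + 1) ^ 2)) * S.card :=
          mul_le_mul_of_nonneg_right hT (by positivity)
      _ = ((balancedColorings (s + 1) u).card * S.card) * (s + 1 : ℝ) ^ ((n + 1) ^ 2) := by ring
      _ ≤ _ := mul_le_mul_of_nonneg_right hw (by positivity)

/-! ### Choice of parameters -/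

/-- The number `n ^ (n / (n - 1))`, with value `1` for `n = 1`. -/
lemma exists_pow_pred_eq {n : ℕ} (hn : 1 ≤ n) :
    ∃ β : ℝ, 1 ≤ β ∧ β ^ (n - 1) = (n : ℝ) ^ n := by
  rcases Nat.lt_or_ge n 2 with h | h
  · obtain rfl : n = 1 := by omega
    exact ⟨1, le_rfl, by simp⟩
  · have hn1 : (1 : ℝ) ≤ n := by exact_mod_cast hn
    exact ⟨((n : ℝ) ^ n) ^ (((n - 1 : ℕ) : ℝ)⁻¹),
      Real.one_le_rpow (one_le_pow₀ hn1) (by positivity),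
      Real.rpow_inv_natCast_pow (by positivity) (by omega)⟩

/-- All losses in the construction are exponential in `k`, which will be about the square root
of `s + 1`: the field has `q ^ k` elements, where `q` is a prime just above a constant times
`β ^ k`. -/
lemma exists_matchings {n : ℕ} (hn : 1 ≤ n) : ∃ E : ℝ, 1 ≤ E ∧ ∀ s k : ℕ, 1 ≤ k →
    s + 1 ≤ k ^ 2 → k ^ 2 ≤ s + 1 + 2 * k →
    ∃ (N : ℕ) (M : Fin N → Finset (Finset (Fin (n + 1) × Fin (s + 1)))),
      (∀ j, (completeUniformHypergraph _ (s + 1)).IsMatchingOfSize (n + 1) (M j)) ∧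
      (∀ (j : Fin (n + 1) → Fin N) (e : Fin (n + 1) → Finset (Fin (n + 1) × Fin (s + 1))),
        (∀ k, e k ∈ M (j k)) → (∀ k l, k ≠ l → Disjoint (e k) (e l)) → ∀ k l, j k = j l) ∧
      ((n + 1 : ℝ) ^ (n + 1) / (n : ℝ) ^ n) ^ (s + 1) ≤ E ^ k * N := by
  obtain ⟨β, hβ, hβn⟩ := exists_pow_pred_eq hn
  have hn1 : (1 : ℝ) ≤ n := by exact_mod_cast hn
  set b : ℝ := 2 * (n + 1 : ℝ) ^ (n + 3) with hb
  have hb1 : 1 ≤ b := by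
    have : (1 : ℝ) ≤ (n + 1 : ℝ) ^ (n + 3) := one_le_pow₀ (by linarith)
    linarith
  -- the factors that do not depend on `k`
  set E₀ : ℝ := (n + 1 : ℝ) ^ (n + 1) * 2 * (4 * b) ^ 2 with hE₀
  have hE₀1 : 1 ≤ E₀ := by
    have h1 : (1 : ℝ) ≤ (n + 1 : ℝ) ^ (n + 1) := one_le_pow₀ (by linarith)
    have h2 : (1 : ℝ) ≤ (4 * b) ^ 2 := one_le_pow₀ (by linarith)
    nlinarith
  refine ⟨E₀ * ((4 * b) ^ (n - 1) * (n : ℝ) ^ (2 * n) * 4 ^ ((n + 1) ^ 2) * 2 * β ^ 2 * n),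
    ?_, ?_⟩
  · have h1 : (1 : ℝ) ≤ (4 * b) ^ (n - 1) := one_le_pow₀ (by linarith)
    have h2 : (1 : ℝ) ≤ (n : ℝ) ^ (2 * n) := one_le_pow₀ hn1
    have h3 : (1 : ℝ) ≤ 4 ^ ((n + 1) ^ 2) := one_le_pow₀ (by norm_num)
    have h4 : (1 : ℝ) ≤ β ^ 2 := one_le_pow₀ hβ
    have m := fun {x y : ℝ} => one_le_mul_of_one_le_of_one_le (a := x) (b := y)
    exact m hE₀1 (m (m (m (m (m h1 h2) h3) one_le_two) h4) hn1)
  intro s k hk hsk hks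
  set x := ⌈b * β ^ k⌉₊ with hx
  have hbβ : 1 ≤ b * β ^ k := one_le_mul_of_one_le_of_one_le hb1 (one_le_pow₀ hβ)
  have hx0 : x ≠ 0 := by
    rw [hx]
    exact (Nat.ceil_pos.2 (by linarith)).ne'
  obtain ⟨q, hqp, hxq, hqx⟩ := Nat.exists_prime_lt_and_le_two_mul x hx0
  have hq_lower : b * β ^ k ≤ q := (Nat.le_ceil _).trans (by exact_mod_cast hxq.le)
  have hq_upper : (q : ℝ) ≤ 4 * b * β ^ k := by
    have h1 : (q : ℝ) ≤ 2 * x := by exact_mod_cast hqx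
    have h2 : (x : ℝ) < b * β ^ k + 1 := Nat.ceil_lt_add_one (by linarith)
    linarith
  have hq0 : (0 : ℝ) < q := by linarith
  obtain ⟨F, hFf, hFt, S, hFcard, hS, hScard⟩ := exists_field_averageFree hn hk hqp
  have hF : b * β ^ (s + 1) ≤ Fintype.card F := by
    rw [hFcard]
    push_cast
    calc b * β ^ (s + 1) ≤ b ^ k * β ^ (k ^ 2) := by
          gcongr
          · exact le_self_pow₀ hb1 (by omega)
      _ = (b * β ^ k) ^ k := by rw [mul_pow b (β ^ k), ← pow_mul β, sq k]
      _ ≤ (q : ℝ) ^ k := by gcongr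
  obtain ⟨N, M, hM, hcross, hN⟩ := exists_matchings_of_averageFree hn s hS hβ
    (fun a ha han => pow_self_le_pow_pred hβ hβn ha han) hF
  refine ⟨N, M, hM, hcross, ?_⟩
  rw [hFcard] at hN
  push_cast at hN
  have hScard' : (q : ℝ) ^ k ≤ S.card * (k * (q : ℝ) ^ 2) * (n : ℝ) ^ k := by
    exact_mod_cast hScard
  set Y : ℝ := (s + 1 : ℝ) ^ ((n + 1) ^ 2) with hY
  -- The density of `S` makes one factor `q ^ k` cancel.
  have h1 : (n + 1 : ℝ) ^ ((n + 1) * s)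
      ≤ 2 * ((q : ℝ) ^ k) ^ (n - 1) * N * Y * (k * (q : ℝ) ^ 2) * (n : ℝ) ^ k := by
    have hqk : (0 : ℝ) < (q : ℝ) ^ k := by positivity
    refine le_of_mul_le_mul_right ?_ hqk
    calc (n + 1 : ℝ) ^ ((n + 1) * s) * (q : ℝ) ^ k
        ≤ (n + 1 : ℝ) ^ ((n + 1) * s) * (S.card * (k * (q : ℝ) ^ 2) * (n : ℝ) ^ k) := by gcongr
      _ = ((n + 1 : ℝ) ^ ((n + 1) * s) * S.card) * ((k * (q : ℝ) ^ 2) * (n : ℝ) ^ k) := by ring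
      _ ≤ (2 * ((q : ℝ) ^ k) ^ n * N * Y) * ((k * (q : ℝ) ^ 2) * (n : ℝ) ^ k) := by gcongr
      _ = _ := by
          obtain ⟨m, rfl⟩ : ∃ m, n = m + 1 := ⟨n - 1, by omega⟩
          rw [Nat.add_sub_cancel, pow_succ ((q : ℝ) ^ k) m]
          ring
  have h2 : ((q : ℝ) ^ k) ^ (n - 1)
      ≤ ((4 * b) ^ (n - 1)) ^ k * (((n : ℝ) ^ (2 * n)) ^ k * ((n : ℝ) ^ n) ^ (s + 1)) := by
    calc ((q : ℝ) ^ k) ^ (n - 1) ≤ ((4 * b * β ^ k) ^ k) ^ (n - 1) := by gcongr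
      _ = ((4 * b) ^ (n - 1)) ^ k * (β ^ (n - 1)) ^ (k ^ 2) := by
          simp only [mul_pow, ← pow_mul]
          congr 2 <;> ring
      _ ≤ ((4 * b) ^ (n - 1)) ^ k * ((n : ℝ) ^ n) ^ (s + 1 + 2 * k) := by
          rw [hβn]
          gcongr
          exact one_le_pow₀ hn1
      _ = _ := by
          rw [pow_add, mul_comm (((n : ℝ) ^ n) ^ (s + 1))]
          simp only [← pow_mul]
          congr 3
          ring
  have hk2 : (k : ℝ) ≤ 2 ^ k := by exact_mod_cast k.lt_two_pow_self.le
  have h3 : Y ≤ (4 ^ ((n + 1) ^ 2)) ^ k := by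
    have : (s + 1 : ℝ) ≤ 4 ^ k := by
      calc (s + 1 : ℝ) ≤ (k : ℝ) ^ 2 := by exact_mod_cast hsk
        _ ≤ (2 ^ k) ^ 2 := by gcongr
        _ = 4 ^ k := by rw [← pow_mul, mul_comm, pow_mul]; norm_num
    calc Y ≤ (4 ^ k) ^ ((n + 1) ^ 2) := by rw [hY]; gcongr
      _ = _ := by rw [← pow_mul, ← pow_mul, mul_comm]
  have h4 : (q : ℝ) ^ 2 ≤ (4 * b) ^ 2 * (β ^ 2) ^ k := by
    calc (q : ℝ) ^ 2 ≤ (4 * b * β ^ k) ^ 2 := by gcongr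
      _ = _ := by rw [mul_pow, ← pow_mul, ← pow_mul, mul_comm k]
  rw [div_pow, div_le_iff₀ (by positivity)]
  calc ((n + 1 : ℝ) ^ (n + 1)) ^ (s + 1)
      = (n + 1 : ℝ) ^ (n + 1) * (n + 1 : ℝ) ^ ((n + 1) * s) := by
        rw [← pow_mul, ← pow_add]
        congr 1
        ring
    _ ≤ (n + 1 : ℝ) ^ (n + 1) *
        (2 * (((4 * b) ^ (n - 1)) ^ k * (((n : ℝ) ^ (2 * n)) ^ k * ((n : ℝ) ^ n) ^ (s + 1))) * N
          * (4 ^ ((n + 1) ^ 2)) ^ k * (2 ^ k * ((4 * b) ^ 2 * (β ^ 2) ^ k)) * (n : ℝ) ^ k) := by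
        refine mul_le_mul_of_nonneg_left (h1.trans ?_) (by positivity)
        gcongr
    _ = E₀ * (((4 * b) ^ (n - 1) * (n : ℝ) ^ (2 * n) * 4 ^ ((n + 1) ^ 2) * 2 * β ^ 2 * n) ^ k
          * N * ((n : ℝ) ^ n) ^ (s + 1)) := by
        rw [hE₀]
        simp only [mul_pow]
        ring
    _ ≤ E₀ ^ k * (((4 * b) ^ (n - 1) * (n : ℝ) ^ (2 * n) * 4 ^ ((n + 1) ^ 2) * 2 * β ^ 2 * n) ^ k
          * N * ((n : ℝ) ^ n) ^ (s + 1)) := by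
        refine mul_le_mul_of_nonneg_right (le_self_pow₀ hE₀1 (by omega)) (by positivity)
    _ = _ := by
        rw [mul_pow E₀]
        ring

lemma existsRainbowFreeFamily_of_forall_eq {V : Type} {r t N : ℕ} (ht : 2 ≤ t)
    (H : UniformHypergraph V r) (M : Fin N → Finset (Finset V))
    (hM : ∀ j, H.IsMatchingOfSize t (M j))
    (hcross : ∀ (j : Fin t → Fin N) (e : Fin t → Finset V),
      (∀ k, e k ∈ M (j k)) → (∀ k l, k ≠ l → Disjoint (e k) (e l)) → ∀ k l, j k = j l) :
    ExistsRainbowFreeFamily r t N := by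
  refine ⟨V, H, M, hM, ?_⟩
  rintro ⟨i, e, hi, he, hdisj⟩
  have := hi (hcross i e he hdisj ⟨0, by omega⟩ ⟨1, by omega⟩)
  simp at this

theorem theorem4p2 (t : ℕ) (ht : 2 ≤ t) :
    ∃ D : ℝ, 0 ≤ D ∧ ∀ r : ℕ, 2 ≤ r →
      (∃ (V : Type) (_ : Fintype V) (H : UniformHypergraph V r) (N : ℕ)
          (M : Fin N → Finset (Finset V)),
        Fintype.card V = t * r ∧
        (∀ j, H.IsMatchingOfSize t (M j)) ∧
        ((t : ℝ) ^ t / ((t : ℝ) - 1) ^ (t - 1)) ^ ((r : ℝ) - D * Real.sqrt r) ≤ (N : ℝ) ∧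
        ∀ (j : Fin t → Fin N) (e : Fin t → Finset V),
          (∀ k, e k ∈ M (j k)) → (∀ k l, k ≠ l → Disjoint (e k) (e l)) →
            ∀ k l, j k = j l) ∧
      ENNReal.ofReal (((t : ℝ) ^ t / ((t : ℝ) - 1) ^ (t - 1)) ^ ((r : ℝ) - D * Real.sqrt r))
        ≤ (rainbowF r t : ENNReal) := by
  obtain ⟨n, rfl⟩ : ∃ n, t = n + 1 := ⟨t - 1, by omega⟩
  have hn : 1 ≤ n := by omega
  obtain ⟨E, hE, hmain⟩ := exists_matchings hn
  have hcast : ((n + 1 : ℕ) : ℝ) - 1 = n := by simp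
  rw [hcast, Nat.add_sub_cancel]
  set c : ℝ := ((n + 1 : ℕ) : ℝ) ^ (n + 1) / (n : ℝ) ^ n with hc
  have hn0 : (0 : ℝ) < n := by exact_mod_cast hn
  have hc1 : 1 < c := by
    rw [hc, one_lt_div (by positivity)]
    push_cast
    calc (n : ℝ) ^ n ≤ (n + 1 : ℝ) ^ n := by gcongr; linarith
      _ < (n + 1 : ℝ) ^ (n + 1) := pow_lt_pow_right₀ (by linarith) (Nat.lt_succ_self n)
  have hlog : 0 < Real.log c := Real.log_pos hc1
  refine ⟨2 * Real.log E / Real.log c, div_nonneg (by linarith [Real.log_nonneg hE]) hlog.le, ?_⟩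
  intro r hr
  obtain ⟨s, rfl⟩ : ∃ s, r = s + 1 := ⟨r - 1, by omega⟩
  set k := Nat.sqrt (s + 1) with hk
  have hk1 : 1 ≤ k := Nat.le_sqrt.2 (by omega)
  have hk2 : k * k ≤ s + 1 := Nat.sqrt_le _
  have hk3 : s + 1 < (k + 1) * (k + 1) := Nat.lt_succ_sqrt _
  obtain ⟨N, M, hM, hcross, hN⟩ := hmain s (k + 1) (by omega) (by nlinarith) (by nlinarith)
  have hbound : c ^ (((s + 1 : ℕ) : ℝ)
      - 2 * Real.log E / Real.log c * Real.sqrt ((s + 1 : ℕ) : ℝ)) ≤ (N : ℝ) := by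
    have hksqrt : ((k + 1 : ℕ) : ℝ) ≤ 2 * Real.sqrt ((s + 1 : ℕ) : ℝ) := by
      have h1 : (k : ℝ) ≤ Real.sqrt ((s + 1 : ℕ) : ℝ) :=
        Real.le_sqrt_of_sq_le (by rw [sq]; exact_mod_cast hk2)
      have h2 : (1 : ℝ) ≤ k := by exact_mod_cast hk1
      push_cast at h1 ⊢
      linarith
    have hEk : E ^ (k + 1)
        ≤ c ^ (2 * Real.log E / Real.log c * Real.sqrt ((s + 1 : ℕ) : ℝ)) := by
      have h1 : 2 * Real.log E / Real.log c * Real.sqrt ((s + 1 : ℕ) : ℝ)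
          = Real.log E / Real.log c * (2 * Real.sqrt ((s + 1 : ℕ) : ℝ)) := by ring
      have h2 : c ^ (Real.log E / Real.log c) = E := by
        rw [Real.rpow_def_of_pos (by linarith), mul_div_cancel₀ _ hlog.ne',
          Real.exp_log (by linarith)]
      rw [h1, Real.rpow_mul (by linarith), h2, ← Real.rpow_natCast]
      exact Real.rpow_le_rpow_of_exponent_le hE hksqrt
    rw [Real.rpow_sub (by linarith), div_le_iff₀ (Real.rpow_pos_of_pos (by linarith) _),
      Real.rpow_natCast, mul_comm]
    refine le_trans ?_ (mul_le_mul_of_nonneg_right hEk (Nat.cast_nonneg N))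
    rw [hc]
    exact_mod_cast hN
  refine ⟨⟨Fin (n + 1) × Fin (s + 1), inferInstance, completeUniformHypergraph _ _, N, M,
    by simp, hM, hbound, hcross⟩, ?_⟩
  have hfree := existsRainbowFreeFamily_of_forall_eq ht _ M hM hcross
  calc ENNReal.ofReal _ ≤ ENNReal.ofReal (N : ℝ) := ENNReal.ofReal_le_ofReal hbound
    _ = ((N : ℕ∞) : ENNReal) := by simp
    _ ≤ (rainbowF (s + 1) (n + 1) : ENNReal) := by
        rw [ENat.toENNReal_le]
        exact le_iSup (fun N : {N : ℕ // ExistsRainbowFreeFamily (s + 1) (n + 1) N} =>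
          ((N : ℕ) : ℕ∞)) ⟨N, hfree⟩
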